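/- Theorem C. Let $F^{*}$ be the class of entire functions of the form $z\mapsto \alpha(z)e^{P(z)}-k$, where $\alpha$ is a nonzero complex polynomial, $P$ is a nonconstant complex polynomial and $k\in\mathbb{C}\setminus\{0\}$. Let $f,g\in F^{*}$ and let $a$ be a nonzero complex polynomial. Then at least one of the functions $fg'-a$ and $gf'-a$ has infinitely many zeros in $\mathbb{C}$. -/

import Mathlib

/-- The class `F*` of entire functions `z ↦ α(z) e^{P(z)} - k`, where `α` is a nonzero complex
polynomial, `P` is a nonconstant complex polynomial and `k` is a nonzero complex constant. -/
def FStar : Set (ℂ → ℂ) :=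
  {f | ∃ (α P : Polynomial ℂ) (k : ℂ), α ≠ 0 ∧ 0 < P.natDegree ∧ k ≠ 0 ∧
    f = fun z => α.eval z * Complex.exp (P.eval z) - k}

/-! Write `f = α e^P - k` and `g = β e^Q - l`. With `A = α' + αP'` and `B = β' + βQ'`, both nonzero,
`fg' - a` is the exponential sum `αB e^(P+Q) - kB e^Q - a`. If it has finitely many zeros,
Hadamard's factorization makes it a single term `R e^S`. By linear independence of exponentials over
polynomials (`eq_zero_of_sum_eval_mul_exp_eq_zero`), a sum of two or more essentially different
terms is never of that form (`infinite_zeros_sum_eval_mul_exp`). Hence `P + Q` is a constant `c` and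
`αB e^c = a` (`eq_of_finite_zeros`).

If `gf' - a` also has finitely many zeros, then `βA e^c = a`, so `αB = βA`. As `Q' = -P'`, this
reads `αβ' - βα' = 2αβP'`, which is impossible by degrees. -/

/-! ### Linear independence of exponentials over polynomials -/

open Polynomial in
/-- The polynomial `A` with `(α * exp P)' = A * exp P` does not vanish. -/
theorem derivative_add_mul_derivative_ne_zero {α P : ℂ[X]} (hα : α ≠ 0) (hP : 0 < P.natDegree) :
    derivative α + α * derivative P ≠ 0 := by
  intro h
  have h1 : (derivative α).degree < (α * derivative P).degree :=
    (degree_derivative_lt hα).trans_le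
      (degree_le_mul_left _ fun e => hP.ne' (derivative_eq_zero.1 e))
  rw [eq_neg_of_add_eq_zero_left h, degree_neg] at h1
  exact lt_irrefl _ h1

open Polynomial in
/-- Exponentials of polynomials that pairwise differ by a nonconstant polynomial are linearly
independent over the ring of polynomials. -/
theorem eq_zero_of_sum_eval_mul_exp_eq_zero {ι : Type*} (s : Finset ι) (c P : ι → ℂ[X])
    (hP : ∀ i ∈ s, ∀ j ∈ s, i ≠ j → 0 < (P i - P j).natDegree)
    (h : ∀ z : ℂ, ∑ i ∈ s, (c i).eval z * Complex.exp ((P i).eval z) = 0) :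
    ∀ i ∈ s, c i = 0 := by
  classical
  induction s using Finset.induction_on generalizing c P with
  | empty => simp
  | insert a s ha ih =>
    -- Dividing by `exp (P a)` leaves a bare polynomial `b`. Differentiating `d` times kills `b`,
    -- while every other term keeps its exponent and its coefficient stays nonzero if it was
    -- nonzero.
    have key : ∀ (d : ℕ) (b : ℂ[X]) (c : ι → ℂ[X]), derivative^[d] b = 0 →
        (∀ z : ℂ, ∑ i ∈ s, (c i).eval z * Complex.exp ((P i - P a).eval z) + b.eval z = 0) →
        ∀ i ∈ s, c i = 0 := by
      intro d
      induction d with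
      | zero =>
        intro b c hb hz
        have hb : b = 0 := hb
        subst hb
        refine ih c (fun i => P i - P a) ?_ (by simpa using hz)
        intro i hi j hj hij
        simpa using hP i (Finset.mem_insert_of_mem hi) j (Finset.mem_insert_of_mem hj) hij
      | succ d ihd =>
        intro b c hb hz
        have h1 := ihd (derivative b)
          (fun i => derivative (c i) + c i * derivative (P i - P a)) (by simpa using hb) ?_
        · intro i hi
          by_contra hc
          exact derivative_add_mul_derivative_ne_zero hc (hP i (Finset.mem_insert_of_mem hi) a
            (Finset.mem_insert_self _ _) fun e => ha (e ▸ hi)) (h1 i hi)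
        · intro z
          have hd : HasDerivAt (fun z : ℂ => ∑ i ∈ s, (c i).eval z *
              Complex.exp ((P i - P a).eval z) + b.eval z)
              (∑ i ∈ s, ((derivative (c i)).eval z * Complex.exp ((P i - P a).eval z) +
                (c i).eval z * (Complex.exp ((P i - P a).eval z) *
                  (derivative (P i - P a)).eval z)) + (derivative b).eval z) z :=
            (HasDerivAt.fun_sum fun i _ => ((c i).hasDerivAt z).mul
              ((P i - P a).hasDerivAt z).cexp).add (b.hasDerivAt z)
          have h0 : (fun z : ℂ => ∑ i ∈ s, (c i).eval z *
              Complex.exp ((P i - P a).eval z) + b.eval z) = fun _ => 0 := funext hz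
          rw [h0] at hd
          rw [← hd.unique (hasDerivAt_const z 0)]
          congr 1
          refine Finset.sum_congr rfl fun i _ => ?_
          rw [eval_add, eval_mul]
          ring
    have hs : ∀ i ∈ s, c i = 0 := by
      refine key ((c a).natDegree + 1) (c a) c (iterate_derivative_eq_zero (Nat.lt_succ_self _)) ?_
      intro z
      have h1 := h z
      rw [Finset.sum_insert ha] at h1
      have h2 : (∑ i ∈ s, (c i).eval z * Complex.exp ((P i - P a).eval z) + (c a).eval z) *
          Complex.exp ((P a).eval z) = 0 := by
        rw [← h1, add_mul, Finset.sum_mul, add_comm]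
        congr 1
        refine Finset.sum_congr rfl fun i _ => ?_
        rw [mul_assoc, ← Complex.exp_add, eval_sub, sub_add_cancel]
      exact (mul_eq_zero.1 h2).resolve_right (Complex.exp_ne_zero _)
    intro i hi
    rcases Finset.mem_insert.1 hi with rfl | hi
    · refine Polynomial.funext fun z => ?_
      have h1 := h z
      rw [Finset.sum_insert ha, Finset.sum_eq_zero fun j hj => by simp [hs j hj], add_zero] at h1
      simpa using (mul_eq_zero.1 h1).resolve_right (Complex.exp_ne_zero _)
    · exact hs i hi

/-! ### Factorization and growth of entire functions -/

/-- An entire function with finitely many zeros is the product of a polynomial and a zero-free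
entire function. -/
theorem Differentiable.exists_polynomial_mul_of_finite_zeros {f : ℂ → ℂ}
    (hf : Differentiable ℂ f) (hfin : {z | f z = 0}.Finite) :
    ∃ (R : Polynomial ℂ) (g : ℂ → ℂ), R ≠ 0 ∧ Differentiable ℂ g ∧ (∀ z, g z ≠ 0) ∧
      ∀ z, f z = R.eval z * g z := by
  induction hn : {z | f z = 0}.ncard generalizing f with
  | zero =>
    rw [Set.ncard_eq_zero hfin] at hn
    refine ⟨1, f, one_ne_zero, hf, fun z hz => ?_, by simp⟩
    have : z ∈ {z | f z = 0} := hz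
    simp [hn] at this
  | succ n ih =>
    obtain ⟨w, hw⟩ : {z | f z = 0}.Nonempty := by
      rw [← Set.ncard_pos hfin]
      omega
    have hnot : ¬ ∀ᶠ z in nhds w, f z = 0 := fun h =>
      infinite_of_mem_nhds w h hfin
    obtain ⟨m, g₀, hg₀, hg₀w, heq⟩ :=
      (hf.analyticAt w).exists_eventuallyEq_pow_smul_nonzero_iff.2 hnot
    -- The value at `w` fills the removable singularity, so `g` has exactly one zero fewer than `f`.
    let g : ℂ → ℂ := Function.update (fun z => f z / (z - w) ^ m) w (g₀ w)
    have hgne : ∀ z, z ≠ w → g z = f z / (z - w) ^ m := fun z hz =>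
      Function.update_of_ne hz _ _
    have hgw : g w = g₀ w := Function.update_self _ _ _
    have hg : Differentiable ℂ g := by
      intro z
      by_cases hz : z = w
      · subst hz
        refine hg₀.differentiableAt.congr_of_eventuallyEq ?_
        filter_upwards [heq] with y hy
        by_cases hyz : y = z
        · rw [hyz, hgw]
        · rw [hgne y hyz, hy, smul_eq_mul,
            mul_div_cancel_left₀ _ (pow_ne_zero _ (sub_ne_zero.2 hyz))]
      · have h1 : DifferentiableAt ℂ (fun z => f z / (z - w) ^ m) z :=
          (hf z).div (by fun_prop) (pow_ne_zero _ (sub_ne_zero.2 hz))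
        refine h1.congr_of_eventuallyEq ?_
        filter_upwards [isOpen_ne.mem_nhds hz] with y hy
        exact hgne y hy
    have hfg : ∀ z, f z = (z - w) ^ m * g z := by
      intro z
      by_cases hz : z = w
      · subst hz
        rw [hgw, ← smul_eq_mul]
        exact heq.self_of_nhds
      · rw [hgne z hz, mul_div_cancel₀ _ (pow_ne_zero _ (sub_ne_zero.2 hz))]
    have hzeros : {z | g z = 0} = {z | f z = 0} \ {w} := by
      ext z
      by_cases hz : z = w
      · subst hz
        simp [hgw, hg₀w]
      · simp [hfg z, hz, sub_ne_zero.2 hz]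
    obtain ⟨R, k, hR, hk, hk0, hgk⟩ := ih hg (hzeros ▸ hfin.sdiff) (by
      rw [hzeros, Set.ncard_sdiff_singleton_of_mem hw, hn]
      rfl)
    refine ⟨(Polynomial.X - Polynomial.C w) ^ m * R, k,
      mul_ne_zero (pow_ne_zero _ (Polynomial.X_sub_C_ne_zero w)) hR, hk, hk0, fun z => ?_⟩
    rw [hfg, hgk]
    simp [mul_assoc]

/-- A zero-free entire function has an entire logarithm. -/
theorem Differentiable.exists_eq_exp {g : ℂ → ℂ} (hg : Differentiable ℂ g) (h0 : ∀ z, g z ≠ 0) :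
    ∃ h : ℂ → ℂ, Differentiable ℂ h ∧ ∀ z, g z = Complex.exp (h z) := by
  have hd : Differentiable ℂ (fun z => _root_.deriv g z / g z) := by
    intro z
    exact (hg.deriv z).div (hg z) (h0 z)
  obtain ⟨F, hF0, hF⟩ := hd.isExactOn_univ.with_val_at 0 (Complex.log (g 0))
  have hF' : ∀ z, HasDerivAt F (_root_.deriv g z / g z) z := fun z => hF z (Set.mem_univ z)
  have hFd : Differentiable ℂ F := fun z => (hF' z).differentiableAt
  refine ⟨F, hFd, fun z => ?_⟩
  have hconst : ∀ z, HasDerivAt (fun z => g z * Complex.exp (-F z)) 0 z := by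
    intro z
    refine ((hg z).hasDerivAt.fun_mul (hF' z).fun_neg.cexp).congr_deriv ?_
    have := h0 z
    field_simp
    ring
  have h1 := is_const_of_deriv_eq_zero (fun z => (hconst z).differentiableAt)
    (fun z => (hconst z).deriv) z 0
  simp only [hF0, Complex.exp_neg, Complex.exp_log (h0 0), mul_inv_cancel₀ (h0 0)] at h1
  exact eq_of_mul_inv_eq_one h1

/-- An entire function of polynomial growth is a polynomial. -/
theorem Differentiable.exists_polynomial_of_norm_le {h : ℂ → ℂ} (hh : Differentiable ℂ h)
    {C : ℝ} {n : ℕ} (hb : ∀ z, ‖h z‖ ≤ C * (1 + ‖z‖) ^ n) :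
    ∃ S : Polynomial ℂ, ∀ z, h z = S.eval z := by
  have hC : 0 ≤ C := by simpa using (norm_nonneg _).trans (hb 0)
  have hzero : ∀ k, n < k → iteratedDeriv k h 0 = 0 := by
    intro k hk
    -- Cauchy's estimate on `|z| = r ≥ 1` gives `k! C (2r)^n / r^k`, which is at most a constant
    -- times `1/r` because `k > n`.
    have hlim : Filter.Tendsto (fun r : ℝ => k.factorial * (C * 2 ^ n) * r⁻¹) Filter.atTop
        (nhds 0) := by
      simpa using tendsto_inv_atTop_zero.const_mul ((k.factorial : ℝ) * (C * 2 ^ n))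
    have hle : ∀ᶠ r : ℝ in Filter.atTop,
        ‖iteratedDeriv k h 0‖ ≤ k.factorial * (C * 2 ^ n) * r⁻¹ := by
      filter_upwards [Filter.eventually_ge_atTop 1] with r hr
      have hr0 : 0 < r := by linarith
      have h1 := Complex.norm_iteratedDeriv_le_of_forall_mem_sphere_norm_le k hr0
        (c := 0) (f := h) (C := C * (2 * r) ^ n) hh.diffContOnCl (by
          intro z hz
          rw [mem_sphere_zero_iff_norm] at hz
          refine (hb z).trans ?_
          rw [hz]
          gcongr
          linarith)
      refine h1.trans ?_
      obtain ⟨m, rfl⟩ := Nat.exists_eq_add_of_lt hk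
      rw [mul_pow, div_le_iff₀ (by positivity)]
      have h2 : r⁻¹ * r ^ (n + m + 1) = r ^ n * r ^ m := by
        field_simp
        ring
      calc _ = (n + m + 1).factorial * (C * 2 ^ n) * (r ^ n * 1) := by ring
        _ ≤ (n + m + 1).factorial * (C * 2 ^ n) * (r ^ n * r ^ m) := by
          gcongr
          exact one_le_pow₀ hr
        _ = _ := by rw [← h2]; ring
    exact norm_le_zero_iff.1 (ge_of_tendsto hlim hle)
  refine ⟨∑ k ∈ Finset.range (n + 1),
    Polynomial.C ((k.factorial : ℂ)⁻¹ * iteratedDeriv k h 0) * Polynomial.X ^ k, fun z => ?_⟩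
  rw [← Complex.taylorSeries_eq_of_entire' 0 z hh, tsum_eq_sum (s := Finset.range (n + 1))]
  · simp [Polynomial.eval_finsetSum]
  · intro k hk
    rw [hzero k (by simpa using hk)]
    simp

/-! ### Functions of finite order and Hadamard's factorization -/

/-- The functions on `ℂ` of finite order of growth. -/
def FiniteOrder (f : ℂ → ℂ) : Prop :=
  ∃ (C : ℝ) (n : ℕ), 0 ≤ C ∧ ∀ z, ‖f z‖ ≤ Real.exp (C * (1 + ‖z‖) ^ n)

theorem Polynomial.exists_norm_eval_le (p : Polynomial ℂ) :
    ∃ (C : ℝ) (n : ℕ), 0 ≤ C ∧ ∀ z, ‖p.eval z‖ ≤ C * (1 + ‖z‖) ^ n := by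
  refine ⟨∑ i ∈ p.support, ‖p.coeff i‖, p.natDegree, by positivity, fun z => ?_⟩
  rw [Polynomial.eval_eq_sum, Polynomial.sum, Finset.sum_mul]
  refine norm_sum_le_of_le _ fun i hi => ?_
  rw [norm_mul, norm_pow]
  have h1 : (1 : ℝ) ≤ 1 + ‖z‖ := by linarith [norm_nonneg z]
  gcongr
  calc ‖z‖ ^ i ≤ (1 + ‖z‖) ^ i := by gcongr; linarith
    _ ≤ (1 + ‖z‖) ^ p.natDegree := pow_le_pow_right₀ h1 (Polynomial.le_natDegree_of_mem_supp i hi)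

namespace FiniteOrder

variable {f g : ℂ → ℂ}

theorem exists_common (hf : FiniteOrder f) (hg : FiniteOrder g) :
    ∃ (C : ℝ) (n : ℕ), 0 ≤ C ∧ (∀ z, ‖f z‖ ≤ Real.exp (C * (1 + ‖z‖) ^ n)) ∧
      ∀ z, ‖g z‖ ≤ Real.exp (C * (1 + ‖z‖) ^ n) := by
  obtain ⟨C, n, hC, hf⟩ := hf
  obtain ⟨D, m, hD, hg⟩ := hg
  refine ⟨max C D, max n m, le_max_of_le_left hC, fun z => (hf z).trans ?_,
    fun z => (hg z).trans ?_⟩ <;>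
  · have h1 : (1 : ℝ) ≤ 1 + ‖z‖ := by linarith [norm_nonneg z]
    gcongr
    all_goals simp

theorem add (hf : FiniteOrder f) (hg : FiniteOrder g) : FiniteOrder fun z => f z + g z := by
  obtain ⟨C, n, hC, hf, hg⟩ := hf.exists_common hg
  refine ⟨C + 1, n, by positivity, fun z => (norm_add_le _ _).trans ?_⟩
  have h1 : (1 : ℝ) ≤ (1 + ‖z‖) ^ n := one_le_pow₀ (by linarith [norm_nonneg z])
  have h2 : (2 : ℝ) ≤ Real.exp ((1 + ‖z‖) ^ n) := by
    linarith [Real.add_one_le_exp ((1 + ‖z‖) ^ n)]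
  rw [add_mul, one_mul, Real.exp_add]
  nlinarith [hf z, hg z, Real.exp_pos (C * (1 + ‖z‖) ^ n)]

theorem mul (hf : FiniteOrder f) (hg : FiniteOrder g) : FiniteOrder fun z => f z * g z := by
  obtain ⟨C, n, hC, hf, hg⟩ := hf.exists_common hg
  refine ⟨C + C, n, by positivity, fun z => ?_⟩
  rw [norm_mul, add_mul, Real.exp_add]
  gcongr
  · exact hf z
  · exact hg z

theorem polynomial_eval (p : Polynomial ℂ) : FiniteOrder fun z => p.eval z := by
  obtain ⟨C, n, hC, h⟩ := p.exists_norm_eval_le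
  refine ⟨C, n, hC, fun z => (h z).trans ?_⟩
  linarith [Real.add_one_le_exp (C * (1 + ‖z‖) ^ n)]

theorem exp_polynomial_eval (p : Polynomial ℂ) :
    FiniteOrder fun z => Complex.exp (p.eval z) := by
  obtain ⟨C, n, hC, h⟩ := p.exists_norm_eval_le
  refine ⟨C, n, hC, fun z => (Complex.norm_exp_le_exp_norm _).trans ?_⟩
  exact Real.exp_le_exp.2 (h z)

theorem sum {ι : Type*} (s : Finset ι) {F : ι → ℂ → ℂ} (h : ∀ i ∈ s, FiniteOrder (F i)) :
    FiniteOrder fun z => ∑ i ∈ s, F i z := by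
  classical
  induction s using Finset.induction_on with
  | empty => exact ⟨0, 0, le_rfl, fun z => by simp⟩
  | insert a s ha ih =>
    simp only [Finset.sum_insert ha]
    exact (h a (Finset.mem_insert_self _ _)).add
      (ih fun i hi => h i (Finset.mem_insert_of_mem hi))

/-- A continuous quotient of a function of finite order by a polynomial is of finite order. -/
theorem of_polynomial_mul {R : Polynomial ℂ} (hR : R ≠ 0) (hg : Continuous g)
    (hf : FiniteOrder fun z => R.eval z * g z) : FiniteOrder g := by
  -- Outside a disc `|R|` is bounded below, so `g` inherits the growth of the product; inside,
  -- compactness bounds `g`.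
  obtain ⟨c, hc, r, hr⟩ : ∃ c > 0, ∃ r : ℝ, ∀ z, r ≤ ‖z‖ → c ≤ ‖R.eval z‖ := by
    by_cases hd : R.degree ≤ 0
    · rw [Polynomial.eq_C_of_degree_le_zero hd] at hR ⊢
      refine ⟨‖R.coeff 0‖, by simpa using hR, 0, fun z _ => by simp⟩
    · have h1 : Filter.Tendsto (fun z => ‖R.eval z‖) (Filter.comap norm Filter.atTop)
          Filter.atTop :=
        R.tendsto_norm_atTop (not_le.1 hd) Filter.tendsto_comap
      have h2 := h1.eventually_ge_atTop 1
      rw [Filter.eventually_comap] at h2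
      obtain ⟨r, hr⟩ := Filter.eventually_atTop.1 h2
      exact ⟨1, one_pos, r, fun z hz => hr _ hz z rfl⟩
  obtain ⟨M, hM⟩ := (isCompact_closedBall (0 : ℂ) r).exists_bound_of_continuousOn hg.continuousOn
  obtain ⟨C, n, hC, hf⟩ := hf
  refine ⟨C + c⁻¹ + |M|, n, by positivity, fun z => ?_⟩
  have h1 : (1 : ℝ) ≤ (1 + ‖z‖) ^ n := one_le_pow₀ (by linarith [norm_nonneg z])
  set y := (1 + ‖z‖) ^ n
  rcases le_or_gt r ‖z‖ with hz | hz
  · have h2 : ‖g z‖ ≤ c⁻¹ * Real.exp (C * y) := by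
      rw [inv_mul_eq_div, le_div_iff₀ hc]
      have := hf z
      rw [norm_mul] at this
      nlinarith [hr z hz, norm_nonneg (g z)]
    refine h2.trans ?_
    have h3 : c⁻¹ ≤ Real.exp ((c⁻¹ + |M|) * y) := by
      have h4 : c⁻¹ ≤ (c⁻¹ + |M|) * y := by
        have := inv_pos.2 hc
        nlinarith [abs_nonneg M]
      linarith [Real.add_one_le_exp ((c⁻¹ + |M|) * y)]
    rw [show (C + c⁻¹ + |M|) * y = (c⁻¹ + |M|) * y + C * y by ring, Real.exp_add]
    gcongr
  · have h2 : ‖g z‖ ≤ |M| := (hM z (by simpa using hz.le)).trans (le_abs_self M)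
    have h4 : |M| ≤ (C + c⁻¹ + |M|) * y := by
      have h5 : 0 ≤ C + c⁻¹ := by positivity
      nlinarith [abs_nonneg M]
    linarith [Real.add_one_le_exp ((C + c⁻¹ + |M|) * y)]

/-- If `exp ∘ h` is of finite order, then the entire function `h` is a polynomial. -/
theorem exists_polynomial_of_exp {h : ℂ → ℂ} (hh : Differentiable ℂ h)
    (hf : FiniteOrder fun z => Complex.exp (h z)) :
    ∃ S : Polynomial ℂ, ∀ z, h z = S.eval z := by
  obtain ⟨C, n, hC, hf⟩ := hf
  have hre : ∀ z, (h z).re ≤ C * (1 + ‖z‖) ^ n := by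
    intro z
    have := hf z
    rwa [Complex.norm_exp, Real.exp_le_exp] at this
  refine hh.exists_polynomial_of_norm_le (C := 2 * ((C + 1) * 2 ^ n) + 3 * ‖h 0‖) (n := n)
    fun z => ?_
  have hz := norm_nonneg z
  have h1 : (1 : ℝ) ≤ (1 + ‖z‖) ^ n := one_le_pow₀ (by linarith)
  -- The radius `2|z| + 1` makes the denominator `1 + |z|`, and `1 + |x| ≤ 2(1 + |z|)` on that disc.
  -- Using `C + 1` keeps the bound on the real part positive.
  have hB := Complex.borelCaratheodory (f := h) (M := (C + 1) * (2 * (1 + ‖z‖)) ^ n)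
    (R := 2 * ‖z‖ + 1) (z := z) (by positivity) hh.differentiableOn (by
      intro x hx
      rw [mem_ball_zero_iff] at hx
      refine (hre x).trans ?_
      gcongr
      · linarith
      · linarith) (by positivity) (by rw [mem_ball_zero_iff]; linarith)
  refine hB.trans ?_
  rw [show 2 * ‖z‖ + 1 - ‖z‖ = 1 + ‖z‖ by ring, ← add_div, div_le_iff₀ (by positivity), mul_pow]
  set y := (1 + ‖z‖) ^ n
  have hA : 0 ≤ (C + 1) * 2 ^ n * y := by positivity
  have h2 : ‖h 0‖ * (2 * ‖z‖ + 1 + ‖z‖) ≤ 3 * ‖h 0‖ * y * (1 + ‖z‖) := by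
    have h3 : 3 * ‖h 0‖ * (1 + ‖z‖) * 1 ≤ 3 * ‖h 0‖ * (1 + ‖z‖) * y := by gcongr
    nlinarith [norm_nonneg (h 0)]
  nlinarith

/-- **Hadamard's factorization** of an entire function of finite order with finitely many
zeros. -/
theorem exists_eq_polynomial_mul_exp (hf : FiniteOrder f) (hd : Differentiable ℂ f)
    (hfin : {z | f z = 0}.Finite) :
    ∃ R S : Polynomial ℂ, R ≠ 0 ∧ ∀ z, f z = R.eval z * Complex.exp (S.eval z) := by
  obtain ⟨R, g, hR, hg, hg0, hfg⟩ := hd.exists_polynomial_mul_of_finite_zeros hfin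
  obtain ⟨h, hh, hgh⟩ := hg.exists_eq_exp hg0
  obtain rfl : f = fun z => R.eval z * g z := funext hfg
  have h1 : FiniteOrder g := of_polynomial_mul hR hg.continuous hf
  obtain rfl : g = fun z => Complex.exp (h z) := funext hgh
  obtain ⟨S, hS⟩ := exists_polynomial_of_exp hh h1
  exact ⟨R, S, hR, fun z => by rw [← hS]⟩

end FiniteOrder

/-! ### Zeros of exponential sums -/

open Polynomial in
/-- A sum of at least two terms `c * exp P`, with nonzero polynomials `c` and polynomials `P` that
pairwise differ by a nonconstant polynomial, has infinitely many zeros. -/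
theorem infinite_zeros_sum_eval_mul_exp {ι : Type*} (s : Finset ι) (hs : s.Nontrivial)
    (c P : ι → ℂ[X]) (hc : ∀ i ∈ s, c i ≠ 0)
    (hP : ∀ i ∈ s, ∀ j ∈ s, i ≠ j → 0 < (P i - P j).natDegree) :
    {z : ℂ | ∑ i ∈ s, (c i).eval z * Complex.exp ((P i).eval z) = 0}.Infinite := by
  classical
  intro hfin
  have hord : FiniteOrder fun z => ∑ i ∈ s, (c i).eval z * Complex.exp ((P i).eval z) :=
    .sum s fun i _ => (FiniteOrder.polynomial_eval (c i)).mul (.exp_polynomial_eval (P i))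
  obtain ⟨R, S, hR, hRS⟩ := hord.exists_eq_polynomial_mul_exp (by fun_prop) hfin
  -- If `S` differs from some `P i` by a constant, `R e^S` is absorbed into the `i`-th coefficient,
  -- and another term `j` contradicts independence. Otherwise `-R e^S` is a genuinely new term,
  -- indexed by `none`.
  by_cases hS : ∃ i ∈ s, (S - P i).natDegree = 0
  · obtain ⟨i, hi, hSi⟩ := hS
    obtain ⟨k, hk⟩ := natDegree_eq_zero.1 hSi
    obtain ⟨j, hj, hji⟩ := hs.exists_ne i
    have h := eq_zero_of_sum_eval_mul_exp_eq_zero s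
      (Function.update c i (c i - R * C (Complex.exp k))) P hP (fun z => ?_) j hj
    · rw [Function.update_of_ne hji] at h
      exact hc j hj h
    · have h1 := hRS z
      have h2 : S = P i + C k := by rw [hk]; ring
      rw [← Finset.add_sum_erase s _ hi, h2, eval_add, eval_C, Complex.exp_add] at h1
      rw [← Finset.add_sum_erase s _ hi, Function.update_self,
        Finset.sum_congr rfl fun l hl => by rw [Function.update_of_ne (Finset.ne_of_mem_erase hl)]]
      simp only [eval_sub, eval_mul, eval_C]
      linear_combination h1
  · push Not at hS
    have h := eq_zero_of_sum_eval_mul_exp_eq_zero (Finset.insertNone s)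
      (fun o => o.elim (-R) c) (fun o => o.elim S P) ?_ (fun z => ?_) none (by simp)
    · exact hR (neg_eq_zero.1 h)
    · rintro (_ | i) hi (_ | j) hj hij
      · exact absurd rfl hij
      · exact Nat.pos_of_ne_zero (hS j (by simpa using hj))
      · simp only [Option.elim]
        rw [← natDegree_neg, neg_sub]
        exact Nat.pos_of_ne_zero (hS i (by simpa using hi))
      · exact hP i (by simpa using hi) j (by simpa using hj) fun e => hij (e ▸ rfl)
    · rw [Finset.sum_insertNone]
      simp only [Option.elim, eval_neg]
      rw [hRS z]
      ring

/-! ### Comparison of the two products -/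

open Polynomial

theorem deriv_eval_mul_exp_sub_const (α P : ℂ[X]) (k z : ℂ) :
    deriv (fun z => α.eval z * Complex.exp (P.eval z) - k) z =
      (derivative α + α * derivative P).eval z * Complex.exp (P.eval z) := by
  rw [(((α.hasDerivAt z).fun_mul (P.hasDerivAt z).cexp).sub_const k).deriv]
  simp only [eval_add, eval_mul]
  ring

/-- If `(α * exp P - k) * (B * exp Q) - a`, with `P` and `Q` nonconstant and `α, k, B, a` nonzero, has finitely many zeros, then `P + Q` is constant and `α * B * exp (P + Q) = a`. -/
theorem eq_of_finite_zeros {α P B Q a : ℂ[X]} {k : ℂ} (hα : α ≠ 0) (hP : 0 < P.natDegree)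
    (hk : k ≠ 0) (hB : B ≠ 0) (hQ : 0 < Q.natDegree) (ha : a ≠ 0)
    (h : {z : ℂ | (α.eval z * Complex.exp (P.eval z) - k) *
      (B.eval z * Complex.exp (Q.eval z)) - a.eval z = 0}.Finite) :
    ∃ c : ℂ, P + Q = C c ∧ α * B * C (Complex.exp c) = a := by
  have hkB : -(C k * B) ≠ 0 := neg_ne_zero.2 (mul_ne_zero (C_ne_zero.2 hk) hB)
  by_cases hPQ : (P + Q).natDegree = 0
  · obtain ⟨c, hc⟩ := natDegree_eq_zero.1 hPQ
    refine ⟨c, hc.symm, ?_⟩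
    by_contra hne
    -- The terms with exponents `P + Q = c` and `0` merge; unless they cancel, two terms remain.
    refine infinite_zeros_sum_eval_mul_exp (Finset.univ : Finset (Fin 2)) (by decide)
      ![-(C k * B), α * B * C (Complex.exp c) - a] ![Q, 0] ?_ ?_ (h.subset ?_)
    · simp [Fin.forall_fin_two, hkB, sub_eq_zero, hne]
    · simp [Fin.forall_fin_two, hQ]
    · intro z hz
      have h1 : Complex.exp (P.eval z) * Complex.exp (Q.eval z) = Complex.exp c := by
        rw [← Complex.exp_add, ← eval_add, ← hc, eval_C]
      simp only [Set.mem_ofPred_eq, Fin.sum_univ_two, Matrix.cons_val_zero, Matrix.cons_val_one,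
        eval_neg, eval_mul, eval_sub, eval_C, eval_zero, Complex.exp_zero] at hz ⊢
      linear_combination hz + α.eval z * B.eval z * h1
  · exfalso
    have hPQ := Nat.pos_of_ne_zero hPQ
    -- Up to sign the exponents `P + Q`, `Q`, `0` differ by `P`, `Q` and `P + Q`, all nonconstant.
    refine infinite_zeros_sum_eval_mul_exp (Finset.univ : Finset (Fin 3)) (by decide)
      ![α * B, -(C k * B), -a] ![P + Q, Q, 0] ?_ ?_ (h.subset ?_)
    · simp [Fin.forall_fin_succ, hα, hB, hk, ha]
    · have h1 : 0 < (-Q + -P).natDegree := by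
        rwa [← neg_add, natDegree_neg, add_comm]
      simp [Fin.forall_fin_succ, hP, hQ, hPQ, h1]
    · intro z hz
      have h1 : Complex.exp ((P + Q).eval z) =
          Complex.exp (P.eval z) * Complex.exp (Q.eval z) := by
        rw [eval_add, Complex.exp_add]
      simp only [Set.mem_ofPred_eq, Fin.sum_univ_three, Matrix.cons_val, h1, eval_neg, eval_mul, eval_C, eval_zero,
        Complex.exp_zero] at hz ⊢
      linear_combination hz

theorem theoremC (f g : ℂ → ℂ) (hf : f ∈ FStar) (hg : g ∈ FStar)
    (a : Polynomial ℂ) (ha : a ≠ 0) :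
    {z : ℂ | f z * deriv g z - a.eval z = 0}.Infinite ∨
      {z : ℂ | g z * deriv f z - a.eval z = 0}.Infinite := by
  obtain ⟨α, P, k, hα, hP, hk, rfl⟩ := hf
  obtain ⟨β, Q, l, hβ, hQ, hl, rfl⟩ := hg
  by_contra hfin
  rw [not_or, Set.not_infinite, Set.not_infinite] at hfin
  simp only [deriv_eval_mul_exp_sub_const] at hfin
  obtain ⟨c, hc, hc'⟩ := eq_of_finite_zeros hα hP hk
    (derivative_add_mul_derivative_ne_zero hβ hQ) hQ ha hfin.1
  obtain ⟨d, hd, hd'⟩ := eq_of_finite_zeros hβ hQ hl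
    (derivative_add_mul_derivative_ne_zero hα hP) hP ha hfin.2
  obtain rfl : c = d := C_injective (by rw [← hc, ← hd, add_comm])
  have h1 : α * (derivative β + β * derivative Q) = β * (derivative α + α * derivative P) :=
    mul_right_cancel₀ (C_ne_zero.2 (Complex.exp_ne_zero c)) (hc'.trans hd'.symm)
  have h2 : derivative Q = -derivative P := by
    have := congrArg derivative hc
    rw [derivative_add, derivative_C] at this
    exact eq_neg_of_add_eq_zero_right this
  rw [h2] at h1
  have hP' : derivative P ≠ 0 := fun e => hP.ne' (derivative_eq_zero.1 e)
  have h3 : α * derivative β - β * derivative α = C 2 * (α * β) * derivative P := by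
    rw [show (C 2 : ℂ[X]) = 2 from rfl]
    linear_combination h1
  -- Each product on the left loses degree to a derivative, while the factor `P' ≠ 0` on the right
  -- cannot lower it.
  have h4 : (α * derivative β - β * derivative α).degree < (α * β).degree := by
    refine (degree_sub_le _ _).trans_lt (max_lt ?_ ?_)
    · rw [degree_mul, degree_mul]
      exact WithBot.add_lt_add_left (degree_ne_bot.2 hα) (degree_derivative_lt hβ)
    · rw [degree_mul, degree_mul, add_comm]
      exact WithBot.add_lt_add_right (degree_ne_bot.2 hβ) (degree_derivative_lt hα)
  have h5 : (α * β).degree ≤ (C 2 * (α * β) * derivative P).degree := by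
    rw [degree_mul (p := C 2 * (α * β)), degree_C_mul two_ne_zero, ← degree_mul]
    exact degree_le_mul_left _ hP'
  rw [h3] at h4
  exact absurd h4 (not_lt.2 h5)
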